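/- Let $R$ be a commutative ring (for instance $\mathbb{C}$), let $N,M\ge 0$ be integers, put $L=N+M$, and let $\alpha=(\alpha_1,\dots,\alpha_L)$ and $\gamma=(\gamma_1,\dots,\gamma_L)$ be elements of $R$. For $0\le\mu\le L-1$ put $$f_\mu(z|\alpha|\gamma)=\prod_{j=1}^{\mu}\bigl(\alpha_j+(1-\alpha_j\gamma_j)z\bigr)\prod_{j=\mu+2}^{L}(1-\gamma_j z).$$ For $n\in\{N,M\}$ and a partition $\lambda=(\lambda_1\ge\dots\ge\lambda_n\ge 0)$ with $\lambda_1\le L-n$, the generalized factorial Schur function in $n$ variables is $$s_\lambda(z_1,\dots,z_n|\alpha|\gamma)=\frac{\det\bigl(f_{\lambda_j+n-j}(z_k|\alpha|\gamma)\bigr)_{1\le j,k\le n}}{\prod_{1\le j<k\le n}(z_j-z_k)}.$$ The quotient is taken in the polynomial ring $R[z_1,\dots,z_n]$, where it exists and is unique, so that $s_\lambda$ can be evaluated at arbitrary elements of $R$. **Theorem (dual Cauchy formula).** For all $x=(x_1,\dots,x_N)\in R^N$ and $y=(y_1,\dots,y_M)\in R^M$, $$\sum_{\lambda\subseteq M^N}s_\lambda(x|\alpha|\gamma)\,s_{\hat\lambda}(y|-\alpha|-\gamma)=\prod_{j=1}^{N}\prod_{k=1}^{M}(x_j+y_k)\prod_{1\le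 j<k\le N+M}\bigl(1+\alpha_j(\gamma_k-\gamma_j)\bigr).$$ The sum runs over all partitions $\lambda=(\lambda_1,\dots,\lambda_N)$ with $M\ge\lambda_1\ge\dots\ge\lambda_N\ge 0$. Here $-\alpha=(-\alpha_1,\dots,-\alpha_L)$, $-\gamma=(-\gamma_1,\dots,-\gamma_L)$, and $\hat\lambda=(\hat\lambda_1,\dots,\hat\lambda_M)$ is given by $\hat\lambda_i=|\{j : \lambda_j\le M-i\}|$. -/

import Mathlib

namespace GenFactorialSchur

/-- The product `∏_{1 ≤ j < k ≤ n} (z_j - z_k)`. -/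
def vdm {S : Type*} [CommRing S] {n : ℕ} (z : Fin n → S) : S :=
  ∏ j : Fin n, ∏ k ∈ Finset.Ioi j, (z j - z k)

/-- `f_μ(z|α|γ) = ∏_{j=1}^{μ} (α_j + (1 - α_j γ_j) z) ∏_{j=μ+2}^{L} (1 - γ_j z)`, where `L` is the
total number of parameters `α_1, …, α_L` and `γ_1, …, γ_L`. Parameters are indexed from `1`; the
values of `α` and `γ` at `0` are never used. -/
def f {S : Type*} [CommRing S] (L : ℕ) (α γ : ℕ → S) (μ : ℕ) (z : S) : S :=
  (∏ j ∈ Finset.Icc 1 μ, (α j + (1 - α j * γ j) * z)) *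
    ∏ j ∈ Finset.Icc (μ + 2) L, (1 - γ j * z)

/-- `F_μ(z|α|γ) = det_n (f_{μ_j}(z_k|α|γ))`. -/
def F {S : Type*} [CommRing S] (L : ℕ) (α γ : ℕ → S) {n : ℕ} (μ : Fin n → ℕ) (z : Fin n → S) : S :=
  Matrix.det (Matrix.of fun j k : Fin n => f L α γ (μ j) (z k))

/-- `λ + δ` with `δ = (n-1, n-2, …, 0)`; the index `j : Fin n` counts from `0`. -/
def addDelta {n : ℕ} (lam : Fin n → ℕ) (j : Fin n) : ℕ := lam j + (n - 1 - (j : ℕ))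

/-- The determinant `F_{λ+δ}` in the indeterminates `X_1, …, X_n`, over the ring `R` of
parameters. -/
noncomputable def FPoly {R : Type*} [CommRing R] (L : ℕ) (α γ : ℕ → R) {n : ℕ} (lam : Fin n → ℕ) :
    MvPolynomial (Fin n) R :=
  F L (fun i => MvPolynomial.C (α i)) (fun i => MvPolynomial.C (γ i)) (addDelta lam) MvPolynomial.X

lemma f_eq_eval {S : Type*} [CommRing S] (L : ℕ) (α γ : ℕ → S) (μ : ℕ) (z : S) :
    f L α γ μ z = Polynomial.eval z (f L (fun i => Polynomial.C (α i))
      (fun i => Polynomial.C (γ i)) μ Polynomial.X) := by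
  simp [f, Polynomial.eval_prod]

/-- A determinant `det (p_j(z_k))` of polynomials is divisible by `∏_{j<k} (z_j - z_k)`. -/
lemma vdm_dvd_det {S : Type*} [CommRing S] {n : ℕ} (p : Fin n → Polynomial S) (z : Fin n → S) :
    vdm z ∣ Matrix.det (Matrix.of fun j k : Fin n => (p j).eval (z k)) := by
  nontriviality S
  set q : Polynomial S := ∏ m : Fin n, (Polynomial.X - Polynomial.C (z m)) with hq
  have hqm : q.Monic := Polynomial.monic_prod_of_monic _ _ fun m _ => Polynomial.monic_X_sub_C _
  have hdeg : q.degree ≤ (n : ℕ) := by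
    refine (Polynomial.degree_prod_le _ _).trans ?_
    simp [Polynomial.degree_X_sub_C]
  have hroot : ∀ k, q.eval (z k) = 0 := fun k => by
    rw [hq, Polynomial.eval_prod]
    exact Finset.prod_eq_zero (Finset.mem_univ k) (by simp)
  have key : (Matrix.of fun j k : Fin n => (p j).eval (z k)) =
      (Matrix.of fun j i : Fin n => ((p j) %ₘ q).coeff i) * (Matrix.vandermonde z).transpose := by
    ext j k
    have h1 : (p j).eval (z k) = ((p j) %ₘ q).eval (z k) := by
      conv_lhs => rw [← Polynomial.modByMonic_add_div (p j) q]
      simp [hroot]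
    have h2 : ((p j) %ₘ q).degree < n := (Polynomial.degree_modByMonic_lt _ hqm).trans_le hdeg
    rw [Matrix.of_apply, h1, Matrix.mul_apply]
    by_cases h0 : (p j) %ₘ q = 0
    · simp [h0]
    · rw [Polynomial.eval_eq_sum_range' ((Polynomial.natDegree_lt_iff_degree_lt h0).2 h2),
        ← Fin.sum_univ_eq_sum_range (fun i => ((p j) %ₘ q).coeff i * z k ^ i)]
      simp [Matrix.vandermonde_apply]
  rw [key, Matrix.det_mul, Matrix.det_transpose, Matrix.det_vandermonde]
  refine Dvd.dvd.mul_left ?_ _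
  refine Finset.prod_dvd_prod_of_dvd _ _ fun j _ => Finset.prod_dvd_prod_of_dvd _ _ fun k _ => ?_
  exact ⟨-1, by ring⟩

/-- `F_{λ+δ}` is divisible by `∏_{j<k} (X_j - X_k)`. -/
lemma vdm_dvd_FPoly {R : Type*} [CommRing R] (L : ℕ) (α γ : ℕ → R) {n : ℕ} (lam : Fin n → ℕ) :
    vdm (MvPolynomial.X : Fin n → MvPolynomial (Fin n) R) ∣ FPoly L α γ lam := by
  have h := vdm_dvd_det (fun j => f L (fun i => Polynomial.C (MvPolynomial.C (α i)))
    (fun i => Polynomial.C (MvPolynomial.C (γ i))) (addDelta lam j) Polynomial.X)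
    (MvPolynomial.X : Fin n → MvPolynomial (Fin n) R)
  simp only [← f_eq_eval] at h
  exact h

/-- `X_j - X_k` with `j ≠ k` is not a zero divisor. -/
lemma isRegular_X_sub_X {R : Type*} [CommRing R] {n : ℕ} {j k : Fin n} (h : j ≠ k) :
    IsRegular (MvPolynomial.X j - MvPolynomial.X k : MvPolynomial (Fin n) R) := by
  rw [isRegular_iff_mem_nonZeroDivisors, mem_nonZeroDivisors_iff_right]
  intro p hp
  let φ : MvPolynomial (Fin n) R →ₐ[R] MvPolynomial (Fin n) R := MvPolynomial.aeval
    (Function.update MvPolynomial.X j (MvPolynomial.X j + MvPolynomial.X k))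
  let ψ : MvPolynomial (Fin n) R →ₐ[R] MvPolynomial (Fin n) R := MvPolynomial.aeval
    (Function.update MvPolynomial.X j (MvPolynomial.X j - MvPolynomial.X k))
  have hψφ : ψ.comp φ = AlgHom.id R _ := by
    apply MvPolynomial.algHom_ext
    intro i
    by_cases hi : i = j
    · subst hi
      simp [φ, ψ, Function.update_of_ne h.symm]
    · simp [φ, ψ, Function.update_of_ne hi]
  have h1 : φ p * MvPolynomial.X j = 0 := by
    have := congrArg φ hp
    simpa [φ, Function.update_of_ne h.symm] using this
  have h2 : φ p = 0 := by
    refine (MvPolynomial.isRegular_X (n := j)).right ?_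
    simpa using h1
  have h3 := congrArg (fun g => g p) hψφ
  simpa [h2] using h3.symm

/-- `∏_{j<k} (X_j - X_k)` is not a zero divisor, so that a quotient by it is unique. -/
lemma isRegular_vdm {R : Type*} [CommRing R] (n : ℕ) :
    IsRegular (vdm (MvPolynomial.X : Fin n → MvPolynomial (Fin n) R)) :=
  IsRegular.prod fun _ _ => IsRegular.prod fun _ hk =>
    isRegular_X_sub_X (Finset.mem_Ioi.1 hk).ne

/-- The generalized factorial Schur function `s_λ(·|α|γ)` with parameters `α_1, …, α_L` and
`γ_1, …, γ_L`, as a polynomial in its `n` variables: the quotient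
`F_{λ+δ} / ∏_{1 ≤ j < k ≤ n} (X_j - X_k)`. -/
noncomputable def schurPoly {R : Type*} [CommRing R] (L : ℕ) (α γ : ℕ → R) {n : ℕ}
    (lam : Fin n → ℕ) : MvPolynomial (Fin n) R :=
  Classical.choose (vdm_dvd_FPoly L α γ lam)

lemma schurPoly_spec {R : Type*} [CommRing R] (L : ℕ) (α γ : ℕ → R) {n : ℕ} (lam : Fin n → ℕ) :
    FPoly L α γ lam = vdm MvPolynomial.X * schurPoly L α γ lam :=
  Classical.choose_spec (vdm_dvd_FPoly L α γ lam)

/-- The quotient defining `schurPoly` is the only one. -/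
lemma schurPoly_unique {R : Type*} [CommRing R] (L : ℕ) (α γ : ℕ → R) {n : ℕ} (lam : Fin n → ℕ)
    (P : MvPolynomial (Fin n) R) (hP : FPoly L α γ lam = vdm MvPolynomial.X * P) :
    P = schurPoly L α γ lam :=
  (isRegular_vdm n).left (hP.symm.trans (schurPoly_spec L α γ lam))

/-- The value `s_λ(z|α|γ)` at `z = (z_1, …, z_n)`. -/
noncomputable def schur {R : Type*} [CommRing R] (L : ℕ) (α γ : ℕ → R) {n : ℕ}
    (lam : Fin n → ℕ) (z : Fin n → R) : R :=
  MvPolynomial.eval z (schurPoly L α γ lam)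

lemma F_eq_vdm_mul_schur {R : Type*} [CommRing R] (L : ℕ) (α γ : ℕ → R) {n : ℕ}
    (lam : Fin n → ℕ) (z : Fin n → R) :
    F L α γ (addDelta lam) z = vdm z * schur L α γ lam z := by
  have h := congrArg (MvPolynomial.eval z) (schurPoly_spec L α γ lam)
  have h1 : MvPolynomial.eval z (FPoly L α γ lam) = F L α γ (addDelta lam) z := by
    unfold FPoly F
    rw [RingHom.map_det]
    congr 1
    ext j k
    simp [f]
  have h2 : MvPolynomial.eval z (vdm (MvPolynomial.X : Fin n → MvPolynomial (Fin n) R))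
      = vdm z := by simp [vdm]
  rw [map_mul, h1, h2] at h
  exact h

/-- Over a field, at pairwise distinct `z_1, …, z_n`, the value `s_λ(z|α|γ)` is the quotient
`F_{λ+δ}(z|α|γ) / ∏_{1 ≤ j < k ≤ n} (z_j - z_k)` of values. -/
lemma schur_eq_div {K : Type*} [Field K] (L : ℕ) (α γ : ℕ → K) {n : ℕ}
    (lam : Fin n → ℕ) (z : Fin n → K) (hz : Function.Injective z) :
    schur L α γ lam z = F L α γ (addDelta lam) z / vdm z := by
  have h : vdm z ≠ 0 := Finset.prod_ne_zero_iff.2 fun j _ => Finset.prod_ne_zero_iff.2 fun k hk =>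
    sub_ne_zero.2 (hz.ne (Finset.mem_Ioi.1 hk).ne)
  rw [F_eq_vdm_mul_schur, mul_div_cancel_left₀ _ h]

/-- The partitions `λ = (λ_1 ≥ ⋯ ≥ λ_N ≥ 0)` with `λ_1 ≤ M`, that is `λ ⊆ M^N`. -/
def boxPartitions (N M : ℕ) : Finset (Fin N → ℕ) :=
  (Fintype.piFinset fun _ : Fin N => Finset.range (M + 1)).filter
    fun lam => ∀ i j : Fin N, i ≤ j → lam j ≤ lam i

/-- `λ̂_i = |{j : λ_j ≤ M - i}|` for `1 ≤ i ≤ M`; the index `i : Fin M` counts from `0`. -/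
def hat {N : ℕ} (M : ℕ) (lam : Fin N → ℕ) (i : Fin M) : ℕ :=
  (Finset.univ.filter fun j : Fin N => lam j ≤ M - ((i : ℕ) + 1)).card

end GenFactorialSchur

namespace GenFactorialSchur

open Finset Matrix

variable {R : Type*} [CommRing R]

/-! With `L = N + M`, both sides come from one `L × L` determinant, `det (f_{L-1-r}(z_c))` at `z =
(x, -y)`.

Homogenized, the `f_μ` are binary forms of degree `L - 1`, so the determinant is a constant `d(α,
γ)` times a projective Vandermonde product (`exists_det_fHom`). At the points `z = 1/γ_k` the matrix
is triangular, which gives `d` up to sign as `∏_{j<k} (1 + α_j (γ_k - γ_j))` (`det_fHom_param`,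
`F_rev_eq`).

Laplace expansion along the `x`-columns (`det_eq_sum_laplace`) is a sum over `N`-subsets of rows.
These correspond to the `λ` in the box, and the complementary rows to `λ̂`. The shuffle signs cancel
against the sign change `(α, γ, y) ↦ (-α, -γ, -y)` (`sign_shuffle`, `F_neg`).

Dividing by Vandermonde products needs a domain and distinct parameters, so the identity is proved
for indeterminates over `ℤ` and specialized (`map_schur`). -/

/-! ### Evaluation of the full determinant -/

/-- A product of linear forms in two variables is a binary form. -/
lemma exists_coeff_prod_linear {ι : Type*} [DecidableEq ι] (s : Finset ι) (p q : ι → R) :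
    ∃ c : ℕ → R, ∀ a b : R, ∏ i ∈ s, (p i * b + q i * a) =
      ∑ k ∈ range (#s + 1), c k * (a ^ k * b ^ (#s - k)) := by
  refine ⟨fun k => ∑ t ∈ powersetCard k s, (∏ i ∈ t, q i) * ∏ i ∈ s \ t, p i, fun a b => ?_⟩
  simp_rw [add_comm (_ * b), prod_add, sum_powerset, sum_mul]
  refine sum_congr rfl fun k _ => sum_congr rfl fun t ht => ?_
  obtain ⟨hts, hk⟩ := mem_powersetCard.1 ht
  rw [prod_mul_distrib, prod_mul_distrib, prod_const, prod_const, card_sdiff_of_subset hts, hk]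
  ring

/-- The homogenization of `f_μ(a|α|γ)` to a binary form of degree `L - 1`. -/
def fHom (L : ℕ) (α γ : ℕ → R) (μ : ℕ) (a b : R) : R :=
  (∏ j ∈ Icc 1 μ, (α j * b + (1 - α j * γ j) * a)) * ∏ j ∈ Icc (μ + 2) L, (b - γ j * a)

lemma fHom_one_right (L : ℕ) (α γ : ℕ → R) (μ : ℕ) (z : R) : fHom L α γ μ z 1 = f L α γ μ z := by
  simp [fHom, f]

lemma exists_coeff_fHom (L : ℕ) (α γ : ℕ → R) {μ : ℕ} (hμ : μ < L) :
    ∃ c : Fin L → R, ∀ a b : R, fHom L α γ μ a b =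
      ∑ k : Fin L, c k * (a ^ (k : ℕ) * b ^ (k.rev : ℕ)) := by
  have hd : Disjoint (Icc 1 μ) (Icc (μ + 2) L) := by
    rw [disjoint_left]
    intro j h1 h2
    rw [mem_Icc] at h1 h2
    omega
  -- The index `μ + 1` is missing from both products, so `L - 1` linear factors remain.
  obtain ⟨c, hc⟩ := exists_coeff_prod_linear (Icc 1 μ ∪ Icc (μ + 2) L)
    (fun j => if j ≤ μ then α j else 1) (fun j => if j ≤ μ then 1 - α j * γ j else -γ j)
  have hcard : #(Icc 1 μ ∪ Icc (μ + 2) L) = L - 1 := by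
    rw [card_union_of_disjoint hd, Nat.card_Icc, Nat.card_Icc]
    omega
  refine ⟨fun k => c k, fun a b => ?_⟩
  have h := hc a b
  rw [hcard, Nat.sub_add_cancel (by omega), prod_union hd] at h
  rw [← Fin.sum_univ_eq_sum_range (fun k => c k * (a ^ k * b ^ (L - 1 - k)))] at h
  refine Eq.trans ?_ (h.trans (sum_congr rfl fun k _ => ?_))
  · unfold fHom
    congr 1
    · exact prod_congr rfl fun j hj => by simp [(mem_Icc.1 hj).2]
    · refine prod_congr rfl fun j hj => ?_
      have : ¬ j ≤ μ := by have := (mem_Icc.1 hj).1; omega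
      simp only [if_neg this]
      ring
  · rw [Fin.val_rev, Nat.sub_sub, add_comm 1]

/-- The matrix `(f_{L-1-r}(a_c : b_c))` factors through a projective Vandermonde matrix. -/
lemma exists_det_fHom (L : ℕ) (α γ : ℕ → R) :
    ∃ d : R, ∀ a b : Fin L → R,
      Matrix.det (Matrix.of fun r c : Fin L => fHom L α γ r.rev (a c) (b c)) =
        d * ∏ i : Fin L, ∏ j ∈ Ioi i, (a j * b i - a i * b j) := by
  choose c hc using fun r : Fin L => exists_coeff_fHom L α γ r.rev.isLt
  refine ⟨Matrix.det (Matrix.of c), fun a b => ?_⟩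
  rw [← det_projVandermonde, ← det_transpose (projVandermonde a b), ← det_mul]
  congr 1
  ext r k
  rw [Matrix.of_apply, hc, Matrix.mul_apply]
  rfl

lemma vdm_neg {n : ℕ} (z : Fin n → R) :
    vdm (-z) = (∏ i : Fin n, (-1) ^ (i.rev : ℕ)) * vdm z := by
  unfold vdm
  rw [← prod_mul_distrib]
  refine prod_congr rfl fun j _ => ?_
  rw [show ((j.rev : ℕ)) = #(Ioi j) by rw [Fin.card_Ioi, Fin.val_rev]; omega, ← prod_const,
    ← prod_mul_distrib]
  refine prod_congr rfl fun k _ => ?_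
  simp only [Pi.neg_apply]
  ring

lemma prod_neg_one_rev_mul_self (n : ℕ) :
    (∏ i : Fin n, (-1 : R) ^ (i.rev : ℕ)) * ∏ i : Fin n, (-1 : R) ^ (i.rev : ℕ) = 1 := by
  rw [← prod_mul_distrib]
  exact prod_eq_one fun i _ => by rw [← mul_pow]; simp

/-- `∏_{1 ≤ j < k ≤ L} (1 + α_j (γ_k - γ_j))`. -/
def paramProd (L : ℕ) (α γ : ℕ → R) : R :=
  ∏ j ∈ Icc 1 L, ∏ k ∈ Icc (j + 1) L, (1 + α j * (γ k - γ j))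

lemma prod_Icc_one_eq_prod_rev {L : ℕ} (g : ℕ → R) :
    ∏ k ∈ Icc 1 L, g k = ∏ r : Fin L, g (r.rev + 1) := by
  refine Eq.trans ?_ (Equiv.prod_comp Fin.revPerm (fun r : Fin L => g (r + 1))).symm
  rw [Fin.prod_univ_eq_prod_range (fun r => g (r + 1)),
    show Icc 1 L = Ico 1 (L + 1) by ext; simp, prod_Ico_eq_prod_range]
  simp [add_comm]

/-- At `(1 : γ_{L-c})` the factor `b - γ_{L-c} a` vanishes and occurs in every row `r > c`. On the
diagonal, with `k = L - r`, the factor with index `j < k` is `α_j γ_k + 1 - α_j γ_j`. Homogeneity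
allows these points even where `γ_k` is not invertible. -/
lemma det_fHom_param (L : ℕ) (α γ : ℕ → R) :
    Matrix.det (Matrix.of fun r c : Fin L => fHom L α γ r.rev 1 (γ (c.rev + 1))) =
      paramProd L α γ * vdm (-fun c : Fin L => γ (c.rev + 1)) := by
  rw [det_of_isUpperTriangular]
  · have h1 : ∀ r : Fin L, fHom L α γ r.rev 1 (γ (r.rev + 1)) =
        (∏ j ∈ Icc 1 (r.rev + 1 - 1 : ℕ), (1 + α j * (γ (r.rev + 1) - γ j))) *
          ∏ i ∈ Iio r, (γ (r.rev + 1) - γ (i.rev + 1)) := by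
      intro r
      unfold fHom
      congr 1
      · exact prod_congr rfl fun j _ => by ring
      · symm
        refine prod_bij (fun i _ => (i.rev + 1 : ℕ)) ?_ ?_ ?_ ?_
        · intro i hi
          have := Fin.lt_def.1 (mem_Iio.1 hi)
          rw [mem_Icc, Fin.val_rev, Fin.val_rev]
          omega
        · intro i _ j _ h
          exact Fin.rev_injective (Fin.val_injective (Nat.succ_injective h))
        · intro j hj
          rw [mem_Icc, Fin.val_rev] at hj
          refine ⟨⟨L - j, by omega⟩, ?_, ?_⟩
          · rw [mem_Iio, Fin.lt_def]
            simp only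
            omega
          · rw [Fin.val_rev]
            simp only
            omega
        · intro i _
          ring
    simp only [Matrix.of_apply, h1]
    rw [prod_mul_distrib]
    congr 1
    · rw [← prod_Icc_one_eq_prod_rev
        (fun k => ∏ j ∈ Icc 1 (k - 1), (1 + α j * (γ k - γ j)))]
      refine prod_comm' fun j k => ?_
      simp only [mem_Icc]
      omega
    · unfold vdm
      rw [prod_comm' (t' := univ) (s' := fun i => Ioi i) (by simp)]
      refine prod_congr rfl fun i _ => prod_congr rfl fun j _ => ?_
      simp only [Pi.neg_apply]
      ring
  · intro r c hrc
    have h : (c : ℕ) < r := hrc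
    refine mul_eq_zero_of_right _ (prod_eq_zero (i := (c.rev + 1 : ℕ)) ?_ (by simp))
    rw [mem_Icc, Fin.val_rev, Fin.val_rev]
    omega

lemma prod_sub_eq_vdm_neg {n : ℕ} (z : Fin n → R) :
    ∏ i : Fin n, ∏ j ∈ Ioi i, (z j - z i) = vdm (-z) := by
  unfold vdm
  exact prod_congr rfl fun i _ => prod_congr rfl fun j _ => by simp; ring

lemma vdm_ne_zero [IsDomain R] {n : ℕ} {z : Fin n → R} (hz : Function.Injective z) :
    vdm z ≠ 0 :=
  prod_ne_zero_iff.2 fun _ _ => prod_ne_zero_iff.2 fun _ hk =>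
    sub_ne_zero.2 (hz.ne (mem_Ioi.1 hk).ne)

/-- In `L` variables, `F_δ` is a multiple of the Vandermonde product. -/
lemma F_rev_eq [IsDomain R] (L : ℕ) (α γ : ℕ → R) (hγ : Function.Injective γ) (z : Fin L → R) :
    F L α γ (fun r : Fin L => (r.rev : ℕ)) z = paramProd L α γ * vdm z := by
  obtain ⟨d, hd⟩ := exists_det_fHom L α γ
  set w : Fin L → R := fun c => γ (c.rev + 1) with hw
  have hwi : Function.Injective w := fun i j h =>
    Fin.rev_injective (Fin.val_injective (Nat.succ_injective (hγ h)))
  -- The constant `d` does not depend on the points, so the triangular case determines it.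
  have h1 : d * vdm w = paramProd L α γ * vdm (-w) := by
    rw [← det_fHom_param, hd (fun _ => 1) w]
    congr 1
    exact prod_congr rfl fun i _ => prod_congr rfl fun j _ => by ring
  have h2 : F L α γ (fun r : Fin L => (r.rev : ℕ)) z = d * vdm (-z) := by
    have := hd z (fun _ => 1)
    simp only [fHom_one_right, mul_one] at this
    rw [← prod_sub_eq_vdm_neg, ← this, F]
  rw [vdm_neg, ← mul_assoc] at h1
  rw [h2, mul_right_cancel₀ (vdm_ne_zero hwi) h1, vdm_neg]
  linear_combination paramProd L α γ * vdm z * prod_neg_one_rev_mul_self (R := R) L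

/-- Each of the `μ` factors involving `α` changes sign; the factors `1 - γ_j z` do not. -/
lemma f_neg (L : ℕ) (α γ : ℕ → R) (μ : ℕ) (z : R) :
    f L (-α) (-γ) μ z = (-1) ^ μ * f L α γ μ (-z) := by
  unfold f
  have h : ((-1 : R)) ^ μ = ∏ j ∈ Icc 1 μ, (-1 : R) := by simp
  rw [h, ← mul_assoc, ← prod_mul_distrib]
  congr 1 <;> refine prod_congr rfl fun j _ => ?_ <;> simp only [Pi.neg_apply] <;> ring

lemma F_neg (L : ℕ) (α γ : ℕ → R) {n : ℕ} (μ : Fin n → ℕ) (z : Fin n → R) :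
    F L (-α) (-γ) μ z = (∏ i, (-1) ^ μ i) * F L α γ μ (-z) := by
  unfold F
  rw [← det_mul_column]
  simp only [f_neg, Matrix.of_apply, Pi.neg_apply]

/-! ### Change of base ring -/

section Map

variable {S : Type*} [CommRing S] (φ : R →+* S)

lemma map_vdm {n : ℕ} (z : Fin n → R) : φ (vdm z) = vdm (φ ∘ z) := by
  simp [vdm]

lemma map_f (L : ℕ) (α γ : ℕ → R) (μ : ℕ) (z : R) :
    φ (f L α γ μ z) = f L (φ ∘ α) (φ ∘ γ) μ (φ z) := by
  simp [f]

lemma map_F (L : ℕ) (α γ : ℕ → R) {n : ℕ} (μ : Fin n → ℕ) (z : Fin n → R) :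
    φ (F L α γ μ z) = F L (φ ∘ α) (φ ∘ γ) μ (φ ∘ z) := by
  unfold F
  rw [RingHom.map_det]
  congr 1
  ext j k
  simp [map_f]

/-- The quotient is picked by choice, but the Vandermonde product is regular over every ring, so
uniqueness makes it compatible with base change. -/
lemma map_schurPoly (L : ℕ) (α γ : ℕ → R) {n : ℕ} (lam : Fin n → ℕ) :
    MvPolynomial.map φ (schurPoly L α γ lam) = schurPoly L (φ ∘ α) (φ ∘ γ) lam := by
  apply schurPoly_unique
  have h := congrArg (MvPolynomial.map φ) (schurPoly_spec L α γ lam)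
  rw [map_mul, map_vdm, FPoly, map_F] at h
  have hX : (MvPolynomial.map φ : MvPolynomial (Fin n) R →+* _) ∘ MvPolynomial.X =
      MvPolynomial.X := by
    ext1 i
    simp
  have hC : ∀ β : ℕ → R, (MvPolynomial.map φ : MvPolynomial (Fin n) R →+* _) ∘
      (fun i => MvPolynomial.C (β i)) = fun i => MvPolynomial.C ((φ ∘ β) i) := by
    intro β
    ext1 i
    simp
  rwa [hX, hC, hC] at h

lemma map_schur (L : ℕ) (α γ : ℕ → R) {n : ℕ} (lam : Fin n → ℕ) (z : Fin n → R) :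
    φ (schur L α γ lam z) = schur L (φ ∘ α) (φ ∘ γ) lam (φ ∘ z) := by
  unfold schur
  rw [← map_schurPoly, MvPolynomial.eval_map, ← MvPolynomial.eval₂_comp]

end Map


/-! ### Laplace expansion and splitting of the Vandermonde product -/

/-- Laplace expansion along a set of columns: the row sets run over a system of representatives
`T` with every set of `#m` rows occurring exactly once as the image of `m`. -/
lemma det_eq_sum_laplace {m n τ : Type*} [Fintype m] [Fintype n]
    [DecidableEq m] [DecidableEq n] (A : Matrix (m ⊕ n) (m ⊕ n) R) (T : Finset τ)
    (e : τ → Equiv.Perm (m ⊕ n))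
    (hinj : ∀ s ∈ T, ∀ t ∈ T, (∀ i, ∃ i', e t (Sum.inl i) = e s (Sum.inl i')) → s = t)
    (hsurj : ∀ σ : Equiv.Perm (m ⊕ n), ∃ t ∈ T, ∀ i, ∃ i', σ (Sum.inl i) = e t (Sum.inl i')) :
    A.det = ∑ t ∈ T, ((Equiv.Perm.sign (e t) : ℤ) : R) *
      (Matrix.det (Matrix.of fun i j : m => A (e t (Sum.inl i)) (Sum.inl j)) *
        Matrix.det (Matrix.of fun i j : n => A (e t (Sum.inr i)) (Sum.inr j))) := by
  have hR : ∀ t, ((Equiv.Perm.sign (e t) : ℤ) : R) *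
      (Matrix.det (Matrix.of fun i j : m => A (e t (Sum.inl i)) (Sum.inl j)) *
        Matrix.det (Matrix.of fun i j : n => A (e t (Sum.inr i)) (Sum.inr j))) =
      ∑ pq : Equiv.Perm m × Equiv.Perm n,
        ((Equiv.Perm.sign (e t * Equiv.sumCongr pq.1 pq.2) : ℤ) : R) *
          ∏ k, A ((e t * Equiv.sumCongr pq.1 pq.2) k) k := by
    intro t
    rw [det_apply', det_apply', sum_mul_sum, ← univ_product_univ, sum_product, mul_sum]
    refine sum_congr rfl fun p _ => ?_
    rw [mul_sum]
    refine sum_congr rfl fun q _ => ?_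
    rw [Equiv.Perm.sign_mul, Equiv.Perm.sign_sumCongr, Fintype.prod_sum_type]
    simp only [Matrix.of_apply, Equiv.Perm.mul_apply, Equiv.sumCongr_apply, Sum.map_inl,
      Sum.map_inr]
    push_cast
    ring
  rw [det_apply', sum_congr rfl fun t _ => hR t, ← sum_product']
  -- The `e t` represent the left cosets of `Perm m × Perm n`, so each permutation is uniquely `e t
  -- * (p ⊕ q)`.
  symm
  refine sum_bij (fun x _ => e x.1 * Equiv.sumCongr x.2.1 x.2.2) (fun _ _ => mem_univ _) ?_ ?_
    (fun _ _ => rfl)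
  · rintro ⟨s, p, q⟩ hs ⟨t, p', q'⟩ ht h
    rw [mem_product] at hs ht
    obtain rfl : s = t := by
      refine hinj s hs.1 t ht.1 fun i => ⟨p (p'⁻¹ i), ?_⟩
      have := congrArg (fun g : Equiv.Perm (m ⊕ n) => g (Sum.inl (p'⁻¹ i))) h
      simpa using this.symm
    have h2 := mul_left_cancel h
    have h3 := Equiv.Perm.sumCongrHom_injective (a₁ := (p, q)) (a₂ := (p', q')) h2
    rw [h3]
  · intro σ _
    obtain ⟨t, ht, h⟩ := hsurj σ
    have hm : Set.MapsTo ((e t)⁻¹ * σ) (Set.range Sum.inl) (Set.range Sum.inl) := by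
      rintro _ ⟨i, rfl⟩
      obtain ⟨i', hi'⟩ := h i
      exact ⟨i', by simp [hi']⟩
    obtain ⟨pq, hpq⟩ := Equiv.Perm.mem_sumCongrHom_range_of_perm_mapsTo_inl hm
    refine ⟨(t, pq), by simp [ht], ?_⟩
    change e t * Equiv.Perm.sumCongrHom m n pq = σ
    rw [hpq, mul_inv_cancel_left]

lemma prod_prod_Ioi_add {S : Type*} [CommMonoid S] {N M : ℕ} (h : Fin (N + M) → Fin (N + M) → S) :
    ∏ k, ∏ l ∈ Ioi k, h k l =
      (∏ j : Fin N, ∏ j' ∈ Ioi j, h (Fin.castAdd M j) (Fin.castAdd M j')) *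
        (∏ i : Fin M, ∏ i' ∈ Ioi i, h (Fin.natAdd N i) (Fin.natAdd N i')) *
          ∏ i : Fin M, ∏ j : Fin N, h (Fin.castAdd M j) (Fin.natAdd N i) := by
  have hI : ∀ {n : ℕ} (k : Fin n) (g : Fin n → S),
      ∏ l ∈ Ioi k, g l = ∏ l, if k < l then g l else 1 := by
    intro n k g
    rw [← prod_filter]
    congr 1
    ext
    simp
  simp_rw [hI]
  have h1 : ∀ (i : Fin M) (j : Fin N), ¬ Fin.natAdd N i < Fin.castAdd M j := by
    intro i j hij
    rw [Fin.lt_def, Fin.val_natAdd, Fin.val_castAdd] at hij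
    omega
  have h2 : ∀ (i : Fin M) (j : Fin N), Fin.castAdd M j < Fin.natAdd N i := by
    intro i j
    rw [Fin.lt_def, Fin.val_natAdd, Fin.val_castAdd]
    omega
  have h3 : ∀ j j' : Fin N, Fin.castAdd M j < Fin.castAdd M j' ↔ j < j' := fun _ _ => Iff.rfl
  simp only [Fin.prod_univ_add, h1, h2, if_true, if_false, prod_const_one,
    prod_mul_distrib, Fin.natAdd_lt_natAdd_iff, h3]
  rw [prod_comm (s := (univ : Finset (Fin M))) (t := (univ : Finset (Fin N)))]
  ac_rfl

lemma vdm_append {N M : ℕ} (x : Fin N → R) (y : Fin M → R) :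
    vdm (Fin.append x y) = vdm x * vdm y * ∏ j, ∏ k, (x j - y k) := by
  unfold vdm
  rw [prod_prod_Ioi_add, prod_comm (s := (univ : Finset (Fin M)))]
  simp

/-! ### Partitions in a box as shuffles -/

section Shuffle

variable {N M : ℕ}

/-- The shuffle `j ↦ L - (λ_j + N - j)`, `i ↦ L - (λ̂_i + M - i)` of the row indices. -/
def shuffleVal (lam : Fin N → ℕ) : Fin N ⊕ Fin M → ℕ :=
  Sum.elim (fun j => N + M - (addDelta lam j + 1)) (fun i => N + M - (addDelta (hat M lam) i + 1))

lemma mem_boxPartitions {lam : Fin N → ℕ} :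
    lam ∈ boxPartitions N M ↔ (∀ j, lam j ≤ M) ∧ Antitone lam := by
  simp [boxPartitions, Antitone]

lemma hat_le (lam : Fin N → ℕ) (i : Fin M) : hat M lam i ≤ N :=
  (card_le_univ _).trans_eq (Fintype.card_fin N)

lemma shuffleVal_lt (lam : Fin N → ℕ) (k : Fin N ⊕ Fin M) : shuffleVal lam k < N + M := by
  rcases k with j | i
  · have := j.isLt
    simp only [shuffleVal, Sum.elim_inl]
    omega
  · have := i.isLt
    simp only [shuffleVal, Sum.elim_inr]
    omega

lemma hat_antitone (lam : Fin N → ℕ) : Antitone (hat M lam) := by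
  intro i i' h
  refine card_le_card fun j => ?_
  simp only [mem_filter, mem_univ, true_and]
  have := Fin.le_def.1 h
  omega

lemma shuffleVal_inl {lam : Fin N → ℕ} (hlam : lam ∈ boxPartitions N M) (j : Fin N) :
    (shuffleVal lam (Sum.inl j : Fin N ⊕ Fin M)) = M - lam j + j := by
  have := (mem_boxPartitions.1 hlam).1 j
  have := j.isLt
  simp only [shuffleVal, Sum.elim_inl, addDelta]
  omega

lemma shuffleVal_inr (lam : Fin N → ℕ) (i : Fin M) :
    (shuffleVal lam (Sum.inr i : Fin N ⊕ Fin M)) = N - hat M lam i + i := by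
  have := hat_le lam i
  have := i.isLt
  simp only [shuffleVal, Sum.elim_inr, addDelta]
  omega

lemma shuffleVal_inl_strictMono {lam : Fin N → ℕ} (hlam : lam ∈ boxPartitions N M) :
    StrictMono fun j : Fin N => shuffleVal lam (Sum.inl j : Fin N ⊕ Fin M) := by
  intro j j' h
  have h1 := (mem_boxPartitions.1 hlam).2 h.le
  have h2 := Fin.lt_def.1 h
  simp only [shuffleVal_inl hlam]
  omega

lemma shuffleVal_inr_strictMono (lam : Fin N → ℕ) :
    StrictMono fun i : Fin M => shuffleVal lam (Sum.inr i : Fin N ⊕ Fin M) := by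
  intro i i' h
  have h1 := hat_antitone lam h.le
  have h2 := Fin.lt_def.1 h
  simp only [shuffleVal_inr]
  omega

/-- As `λ` is decreasing, only indices after `j` can be counted by `λ̂_i`. -/
lemma hat_le_of_lt {lam : Fin N → ℕ} (hlam : lam ∈ boxPartitions N M) (i : Fin M) (j : Fin N)
    (h : M - (i + 1) < lam j) : hat M lam i + (j + 1) ≤ N := by
  have h1 : hat M lam i ≤ #(Ioi j) := by
    refine card_le_card fun k hk => ?_
    simp only [mem_filter, mem_univ, true_and, mem_Ioi] at hk ⊢
    by_contra hc
    have := (mem_boxPartitions.1 hlam).2 (not_lt.1 hc)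
    omega
  rw [Fin.card_Ioi] at h1
  omega

lemma le_hat_of_le {lam : Fin N → ℕ} (hlam : lam ∈ boxPartitions N M) (i : Fin M) (j : Fin N)
    (h : lam j ≤ M - (i + 1)) : N - j ≤ hat M lam i := by
  rw [← Fin.card_Ici]
  refine card_le_card fun k hk => ?_
  simp only [mem_filter, mem_univ, true_and, mem_Ici] at hk ⊢
  exact ((mem_boxPartitions.1 hlam).2 hk).trans h

lemma shuffleVal_inl_lt_inr {lam : Fin N → ℕ} (hlam : lam ∈ boxPartitions N M) (i : Fin M)
    (j : Fin N) (h : M - (i + 1) < lam j) :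
    shuffleVal lam (Sum.inl j : Fin N ⊕ Fin M) < shuffleVal lam (Sum.inr i : Fin N ⊕ Fin M) := by
  have := hat_le_of_lt hlam i j h
  have := (mem_boxPartitions.1 hlam).1 j
  rw [shuffleVal_inl hlam, shuffleVal_inr]
  omega

lemma shuffleVal_inr_lt_inl {lam : Fin N → ℕ} (hlam : lam ∈ boxPartitions N M) (i : Fin M)
    (j : Fin N) (h : lam j ≤ M - (i + 1)) :
    shuffleVal lam (Sum.inr i : Fin N ⊕ Fin M) < shuffleVal lam (Sum.inl j : Fin N ⊕ Fin M) := by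
  have := le_hat_of_le hlam i j h
  have := hat_le lam i
  have := i.isLt
  rw [shuffleVal_inl hlam, shuffleVal_inr]
  omega

lemma shuffleVal_injective {lam : Fin N → ℕ} (hlam : lam ∈ boxPartitions N M) :
    Function.Injective (shuffleVal lam : Fin N ⊕ Fin M → ℕ) := by
  have hne : ∀ (j : Fin N) (i : Fin M), shuffleVal lam (Sum.inl j : Fin N ⊕ Fin M) ≠
      shuffleVal lam (Sum.inr i : Fin N ⊕ Fin M) := fun j i =>
    (lt_or_ge (M - ((i : ℕ) + 1)) (lam j)).elim (fun h => (shuffleVal_inl_lt_inr hlam i j h).ne)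
      fun h => (shuffleVal_inr_lt_inl hlam i j h).ne'
  rintro (j | i) (j' | i') h
  · rw [(shuffleVal_inl_strictMono hlam).injective h]
  · exact absurd h (hne j i')
  · exact absurd h.symm (hne j' i)
  · rw [(shuffleVal_inr_strictMono lam).injective h]

/-- The permutation of the indices `1, …, N + M` given by `shuffleVal`. -/
noncomputable def shuffle (lam : Fin N → ℕ) : Equiv.Perm (Fin N ⊕ Fin M) :=
  open Classical in
  if h : lam ∈ boxPartitions N M then
    Equiv.ofBijective (fun k => finSumFinEquiv.symm ⟨shuffleVal lam k, shuffleVal_lt lam k⟩)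
      (Finite.injective_iff_bijective.1 fun _ _ hab => shuffleVal_injective h
        (Fin.mk.inj_iff.1 (finSumFinEquiv.symm.injective hab)))
  -- An arbitrary value: only partitions in the box occur in the expansion.
  else 1

lemma finSumFinEquiv_shuffle {lam : Fin N → ℕ} (hlam : lam ∈ boxPartitions N M)
    (k : Fin N ⊕ Fin M) :
    finSumFinEquiv (shuffle lam k) = ⟨shuffleVal lam k, shuffleVal_lt lam k⟩ := by
  simp [shuffle, hlam]

/-- Both blocks are increasing, so inversions pair some `j` with some `i`; they occur exactly when
`λ_j ≤ M - i` (`i` counted from `1`), hence `λ̂_i` times for each `i`. -/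
lemma sign_shuffle {lam : Fin N → ℕ} (hlam : lam ∈ boxPartitions N M) :
    Equiv.Perm.sign (shuffle lam : Equiv.Perm (Fin N ⊕ Fin M)) =
      ∏ i : Fin M, (-1) ^ hat M lam i := by
  rw [← Equiv.Perm.sign_permCongr finSumFinEquiv, Equiv.Perm.sign_eq_prod_prod_Ioi,
    prod_prod_Ioi_add]
  simp only [Equiv.permCongr_apply, finSumFinEquiv_symm_apply_castAdd,
    finSumFinEquiv_symm_apply_natAdd, finSumFinEquiv_shuffle hlam, Fin.mk_lt_mk]
  have h1 : ∏ j : Fin N, ∏ j' ∈ Ioi j, (if shuffleVal lam (Sum.inl j : Fin N ⊕ Fin M) <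
      shuffleVal lam (Sum.inl j' : Fin N ⊕ Fin M) then (1 : ℤˣ) else -1) = 1 :=
    prod_eq_one fun j _ => prod_eq_one fun j' h =>
      if_pos (shuffleVal_inl_strictMono hlam (mem_Ioi.1 h))
  have h2 : ∏ i : Fin M, ∏ i' ∈ Ioi i, (if shuffleVal lam (Sum.inr i : Fin N ⊕ Fin M) <
      shuffleVal lam (Sum.inr i' : Fin N ⊕ Fin M) then (1 : ℤˣ) else -1) = 1 :=
    prod_eq_one fun i _ => prod_eq_one fun i' h =>
      if_pos (shuffleVal_inr_strictMono lam (mem_Ioi.1 h))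
  rw [h1, h2, one_mul, one_mul]
  refine prod_congr rfl fun i _ => ?_
  rw [hat, ← prod_const, prod_filter]
  refine prod_congr rfl fun j _ => ?_
  rcases lt_or_ge (M - ((i : ℕ) + 1)) (lam j) with h | h
  · rw [if_pos (shuffleVal_inl_lt_inr hlam i j h), if_neg (not_le.2 h)]
  · rw [if_neg (shuffleVal_inr_lt_inl hlam i j h).not_gt, if_pos h]

/-- A finite set has only one increasing enumeration, and `λ` is read off from it. -/
lemma shuffle_inj {lam nu : Fin N → ℕ} (hlam : lam ∈ boxPartitions N M)
    (hnu : nu ∈ boxPartitions N M)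
    (h : ∀ j, ∃ j', (shuffle nu : Equiv.Perm (Fin N ⊕ Fin M)) (Sum.inl j) =
      shuffle lam (Sum.inl j')) : lam = nu := by
  have h1 : ∀ j, ∃ j', shuffleVal nu (Sum.inl j : Fin N ⊕ Fin M) =
      shuffleVal lam (Sum.inl j' : Fin N ⊕ Fin M) := by
    intro j
    obtain ⟨j', hj'⟩ := h j
    refine ⟨j', ?_⟩
    have := congrArg finSumFinEquiv hj'
    rwa [finSumFinEquiv_shuffle hlam, finSumFinEquiv_shuffle hnu, Fin.mk.injEq] at this
  set s := univ.image fun j => shuffleVal lam (Sum.inl j : Fin N ⊕ Fin M) with hs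
  have hcard : #s = N := by
    rw [hs, card_image_of_injective _ (shuffleVal_inl_strictMono hlam).injective, card_fin]
  have hl := orderEmbOfFin_unique hcard (fun j => mem_image_of_mem _ (mem_univ j))
    (shuffleVal_inl_strictMono hlam)
  have hn := orderEmbOfFin_unique hcard (fun j => by
    obtain ⟨j', hj'⟩ := h1 j
    exact hj' ▸ mem_image_of_mem _ (mem_univ j')) (shuffleVal_inl_strictMono hnu)
  ext j
  have h2 := congrFun (hl.trans hn.symm) j
  simp only [shuffleVal_inl hlam, shuffleVal_inl hnu] at h2
  have := (mem_boxPartitions.1 hlam).1 j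
  have := (mem_boxPartitions.1 hnu).1 j
  omega

lemma exists_shuffle (σ : Equiv.Perm (Fin N ⊕ Fin M)) :
    ∃ lam ∈ boxPartitions N M, ∀ j, ∃ j',
      σ (Sum.inl j) = (shuffle lam : Equiv.Perm (Fin N ⊕ Fin M)) (Sum.inl j') := by
  set s := univ.image fun j : Fin N => finSumFinEquiv (σ (Sum.inl j)) with hs
  have hcard : #s = N := by
    rw [hs, card_image_of_injective, card_fin]
    exact finSumFinEquiv.injective.comp (σ.injective.comp Sum.inl_injective)
  set g := s.orderEmbOfFin hcard with hg
  -- The gaps of the increasing enumeration `g` make `j ↦ g j - j` increasing with values in `[0,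
  -- M]`; `λ_j = M - (g j - j)` inverts `shuffleVal_inl`.
  have hstep : ∀ j j' : Fin N, j ≤ j' → (g j : ℕ) + (j' - j) ≤ g j' := by
    intro j j' h
    have h1 : #((Ico j j').image g) = j' - j := by
      rw [card_image_of_injective _ g.injective, Fin.card_Ico]
    have h2 : (Ico j j').image g ⊆ Ico (g j) (g j') := by
      intro k hk
      obtain ⟨l, hl, rfl⟩ := mem_image.1 hk
      rw [mem_Ico] at hl ⊢
      exact ⟨g.monotone hl.1, g.strictMono hl.2⟩
    have h3 := card_le_card h2
    rw [h1, Fin.card_Ico] at h3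
    have h4 := Fin.le_def.1 (g.monotone h)
    omega
  have hlow : ∀ j : Fin N, (j : ℕ) ≤ g j := fun j => by
    have := hstep ⟨0, j.pos⟩ j (Fin.le_def.2 (Nat.zero_le _))
    simp only at this
    omega
  have hup : ∀ j : Fin N, (g j : ℕ) ≤ M + j := fun j => by
    have hj := j.isLt
    have := hstep j ⟨N - 1, by omega⟩ (Fin.le_def.2 (by simp only; omega))
    have := (g ⟨N - 1, by omega⟩).isLt
    simp only at *
    omega
  have hmem : (fun j : Fin N => M - (g j - j)) ∈ boxPartitions N M := by
    refine mem_boxPartitions.2 ⟨fun j => Nat.sub_le _ _, fun j j' h => ?_⟩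
    have := hstep j j' h
    have := hlow j
    have := Fin.le_def.1 h
    simp only
    omega
  refine ⟨_, hmem, fun j => ?_⟩
  have hj : finSumFinEquiv (σ (Sum.inl j)) ∈ Set.range g := by
    rw [hg, range_orderEmbOfFin, mem_coe]
    exact mem_image_of_mem _ (mem_univ j)
  obtain ⟨j', hj'⟩ := hj
  refine ⟨j', finSumFinEquiv.injective ?_⟩
  rw [finSumFinEquiv_shuffle hmem, ← hj', Fin.ext_iff]
  simp only [shuffleVal_inl hmem]
  have := hlow j'
  have := hup j'
  omega

end Shuffle

/-! ### The dual Cauchy formula -/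

/-- The dual Cauchy formula for the determinants `F_{λ+δ}`. -/
lemma sum_F_mul_F [IsDomain R] {N M : ℕ} (x : Fin N → R) (y : Fin M → R) (α γ : ℕ → R)
    (hγ : Function.Injective γ) :
    ∑ lam ∈ boxPartitions N M, F (N + M) α γ (addDelta lam) x *
        F (N + M) (-α) (-γ) (addDelta (hat M lam)) y =
      vdm x * vdm y * ((∏ j : Fin N, ∏ k : Fin M, (x j + y k)) * paramProd (N + M) α γ) := by
  set ε : R := ∏ i : Fin M, (-1) ^ (i.rev : ℕ) with hε
  have hdet := F_rev_eq (N + M) α γ hγ (Fin.append x (-y))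
  rw [vdm_append, vdm_neg, F, ← det_submatrix_equiv_self finSumFinEquiv,
    det_eq_sum_laplace _ (boxPartitions N M) shuffle
      (fun _ hs _ ht => shuffle_inj hs ht) exists_shuffle] at hdet
  have hterm : ∀ lam ∈ boxPartitions N M, F (N + M) α γ (addDelta lam) x *
      F (N + M) (-α) (-γ) (addDelta (hat M lam)) y = ε *
        (((Equiv.Perm.sign (shuffle lam : Equiv.Perm (Fin N ⊕ Fin M)) : ℤ) : R) *
          (F (N + M) α γ (addDelta lam) x *
            F (N + M) α γ (addDelta (hat M lam)) (-y))) := by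
    intro lam hlam
    -- The part `λ̂` of the exponent gives the sign of the shuffle; the part `δ` gives `ε`, which
    -- cancels the sign of `vdm (-y)`.
    have hs : ∏ i, (-1 : R) ^ addDelta (hat M lam) i =
        (∏ i : Fin M, (-1) ^ hat M lam i) * ε := by
      rw [hε, ← prod_mul_distrib]
      refine prod_congr rfl fun i _ => ?_
      rw [← pow_add, addDelta, Fin.val_rev, Nat.sub_sub, add_comm 1]
    rw [F_neg, hs, sign_shuffle hlam]
    push_cast
    ring
  rw [sum_congr rfl hterm, ← mul_sum]
  have hF : ∀ lam ∈ boxPartitions N M,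
      ((Equiv.Perm.sign (shuffle lam : Equiv.Perm (Fin N ⊕ Fin M)) : ℤ) : R) *
          (F (N + M) α γ (addDelta lam) x * F (N + M) α γ (addDelta (hat M lam)) (-y)) =
      ((Equiv.Perm.sign (shuffle lam : Equiv.Perm (Fin N ⊕ Fin M)) : ℤ) : R) *
        (Matrix.det (Matrix.of fun i j : Fin N => (Matrix.of fun j k : Fin (N + M) =>
          f (N + M) α γ (j.rev : ℕ) (Fin.append x (-y) k)).submatrix finSumFinEquiv finSumFinEquiv
            (shuffle lam (Sum.inl i)) (Sum.inl j)) *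
        Matrix.det (Matrix.of fun i j : Fin M => (Matrix.of fun j k : Fin (N + M) =>
          f (N + M) α γ (j.rev : ℕ) (Fin.append x (-y) k)).submatrix finSumFinEquiv finSumFinEquiv
            (shuffle lam (Sum.inr i)) (Sum.inr j))) := by
    intro lam hlam
    congr 2
    · unfold F
      congr 1
      ext i j
      have h1 := (mem_boxPartitions.1 hlam).1 i
      have h2 := i.isLt
      have h3 : N + M - (N + M - (addDelta lam i + 1) + 1) = addDelta lam i := by
        rw [addDelta]
        omega
      simp [finSumFinEquiv_shuffle hlam, shuffleVal, h3]
    · unfold F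
      congr 1
      ext i j
      have h1 := hat_le lam i
      have h2 := i.isLt
      have h3 : N + M - (N + M - (addDelta (hat M lam) i + 1) + 1) = addDelta (hat M lam) i := by
        rw [addDelta]
        omega
      simp [finSumFinEquiv_shuffle hlam, shuffleVal, h3]
  rw [sum_congr rfl hF, hdet]
  simp only [Pi.neg_apply, sub_neg_eq_add]
  linear_combination (vdm x * vdm y * (∏ j : Fin N, ∏ k : Fin M, (x j + y k)) *
    paramProd (N + M) α γ) * prod_neg_one_rev_mul_self (R := R) M

/-- The dual Cauchy formula where all parameters and variables are distinct. -/
lemma sum_schur_mul_schur [IsDomain R] {N M : ℕ} (x : Fin N → R) (y : Fin M → R) (α γ : ℕ → R)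
    (hx : Function.Injective x) (hy : Function.Injective y) (hγ : Function.Injective γ) :
    ∑ lam ∈ boxPartitions N M, schur (N + M) α γ lam x *
        schur (N + M) (-α) (-γ) (hat M lam) y =
      (∏ j : Fin N, ∏ k : Fin M, (x j + y k)) * paramProd (N + M) α γ := by
  refine mul_left_cancel₀ (mul_ne_zero (vdm_ne_zero hx) (vdm_ne_zero hy)) ?_
  rw [← sum_F_mul_F x y α γ hγ, mul_sum]
  refine sum_congr rfl fun lam _ => ?_
  rw [F_eq_vdm_mul_schur, F_eq_vdm_mul_schur]
  ring

end GenFactorialSchur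

theorem mainTheorem6 {R : Type*} [CommRing R] (N M : ℕ) (x : Fin N → R) (y : Fin M → R)
    (α γ : ℕ → R) :
    ∑ lam ∈ GenFactorialSchur.boxPartitions N M,
        GenFactorialSchur.schur (N + M) α γ lam x *
          GenFactorialSchur.schur (N + M) (-α) (-γ) (GenFactorialSchur.hat M lam) y =
      (∏ j : Fin N, ∏ k : Fin M, (x j + y k)) *
        ∏ j ∈ Finset.Icc 1 (N + M), ∏ k ∈ Finset.Icc (j + 1) (N + M),
          (1 + α j * (γ k - γ j)) := by
  -- The universal case: one indeterminate for each `x_j`, `y_k`, `α_i` and `γ_i`.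
  let X : (Fin N ⊕ Fin M) ⊕ (ℕ ⊕ ℕ) → MvPolynomial ((Fin N ⊕ Fin M) ⊕ (ℕ ⊕ ℕ)) ℤ :=
    MvPolynomial.X
  have hX : Function.Injective X := MvPolynomial.X_injective
  let φ : MvPolynomial ((Fin N ⊕ Fin M) ⊕ (ℕ ⊕ ℕ)) ℤ →+* R :=
    MvPolynomial.eval₂Hom (Int.castRingHom R) (Sum.elim (Sum.elim x y) (Sum.elim α γ))
  have h := congrArg φ (GenFactorialSchur.sum_schur_mul_schur
    (X ∘ Sum.inl ∘ Sum.inl) (X ∘ Sum.inl ∘ Sum.inr) (X ∘ Sum.inr ∘ Sum.inl)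
    (X ∘ Sum.inr ∘ Sum.inr)
    (hX.comp (Sum.inl_injective.comp Sum.inl_injective))
    (hX.comp (Sum.inl_injective.comp Sum.inr_injective))
    (hX.comp (Sum.inr_injective.comp Sum.inr_injective)))
  have h1 : φ ∘ X ∘ Sum.inl ∘ Sum.inl = x := by ext; simp [φ, X]
  have h2 : φ ∘ X ∘ Sum.inl ∘ Sum.inr = y := by ext; simp [φ, X]
  have h3 : φ ∘ X ∘ Sum.inr ∘ Sum.inl = α := by ext; simp [φ, X]
  have h4 : φ ∘ X ∘ Sum.inr ∘ Sum.inr = γ := by ext; simp [φ, X]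
  have h5 : φ ∘ (-(X ∘ Sum.inr ∘ Sum.inl)) = -α := by ext; simp [φ, X]
  have h6 : φ ∘ (-(X ∘ Sum.inr ∘ Sum.inr)) = -γ := by ext; simp [φ, X]
  simp only [map_sum, map_mul, GenFactorialSchur.map_schur, h1, h2, h3, h4, h5, h6] at h
  rw [h]
  simp [GenFactorialSchur.paramProd, φ, X]
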